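/- Let $E$ be a complex Banach lattice, i.e. the complexification $E=E_{\mathbb R}\oplus iE_{\mathbb R}$ of a real Banach lattice $E_{\mathbb R}$, with modulus $|x+iy|=\sup_{\theta\in\mathbb R}(x\cos\theta+y\sin\theta)$ and norm $\|z\|=\|\,|z|\,\|$. For $f,g\in E$ write $f\le g$ if $g-f$ lies in the positive cone of $E_{\mathbb R}$, write $0\lneq f$ if $0\le f\neq 0$, and write $f\succeq g$ if there is a constant $c>0$ with $f\ge cg$. A vector $0\le u\in E$ is a quasi-interior point of $E$ if $E_u=\{z\in E: u\succeq|z|\}$ is dense in $E$. A linear operator $A:E\supseteq\operatorname{dom}(A)\to E$ is called real if $\operatorname{dom}(A)$ is spanned by $\operatorname{dom}(A)\cap E_{\mathbb R}$ and $A$ maps $\operatorname{dom}(A)\cap E_{\mathbb R}$ into $E_{\mathbb R}$. Write $\mathcal R(\lambda,A)=(\lambda-A)^{-1}$ for $\lambda$ in the resolvent set of $A$. **Theorem.** Let $A$ and $B$ be closed, densely defined, and real operators on a complex Banach lattice $E$, and let $u\ge 0$ be a quasi-interior point of $E$. Let $\lambda_0\in\mathbb R$ be a spectral value of $B$ and a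 pole of the resolvent $\mathcal R(\cdot,B)$. Assume the following: (a) For each $0\le f\in E$ there is $\delta>0$ (depending on $f$) such that $0\le \mathcal R(\lambda,A)f\le \mathcal R(\lambda,B)f$ for all $\lambda\in(\lambda_0,\lambda_0+\delta)$. (b) For each $0\lneq f\in E$ there is $\delta>0$ (depending on $f$) such that $\mathcal R(\lambda,B)f\succeq u$ for all $\lambda\in(\lambda_0,\lambda_0+\delta)$ (where the constant in $\succeq$ may depend on $f$ and $\lambda$). If, in addition, $\lambda_0$ is a spectral value of $A$ and a pole of the resolvent $\mathcal R(\cdot,A)$, then $A=B$ (in particular $\operatorname{dom}(A)=\operatorname{dom}(B)$). -/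

import Mathlib

open Filter Topology

/-- Let `X` be a real lattice-ordered vector space and `j : X → E` a real-linear map into a complex
vector space. `IsModulus j z m` says that `z` has the form `j x + i j y` and that `m` is its modulus
`|z| = sup {cos θ • x + sin θ • y | θ ∈ ℝ}` (the supremum is taken in `X`). -/
def IsModulus {X E : Type*} [AddCommGroup X] [Module ℝ X] [Lattice X]
    [NormedAddCommGroup E] [NormedSpace ℂ E] (j : X →ₗ[ℝ] E) (z : E) (m : X) : Prop :=
  ∃ x y : X, z = j x + Complex.I • j y ∧
    IsLUB (Set.range fun θ : ℝ => Real.cos θ • x + Real.sin θ • y) m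

/-- `E` is a complex Banach lattice whose real part is the real Banach lattice `X`, embedded by
`j : X → E`: every vector of `E` is `j x + i j y` for unique `x y : X`, every vector has a modulus,
and the norm of a vector is the norm of its modulus. -/
structure IsComplexBanachLattice {X E : Type*}
    [NormedAddCommGroup X] [NormedSpace ℝ X] [CompleteSpace X]
    [Lattice X] [IsOrderedAddMonoid X] [IsOrderedModule ℝ X] [HasSolidNorm X]
    [NormedAddCommGroup E] [NormedSpace ℂ E] [CompleteSpace E] (j : X →ₗ[ℝ] E) : Prop where
  existsUnique_repr : ∀ z : E, ∃! p : X × X, z = j p.1 + Complex.I • j p.2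
  exists_modulus : ∀ z : E, ∃ m : X, IsModulus j z m ∧ ‖z‖ = ‖m‖

/-- The order of a complex Banach lattice `E` with real part `X`: `z ≤ w` if and only if `w - z`
belongs to the positive cone of `X`. -/
def ComplexLE {X E : Type*} [AddCommGroup X] [Module ℝ X] [Lattice X]
    [NormedAddCommGroup E] [NormedSpace ℂ E] (j : X →ₗ[ℝ] E) (z w : E) : Prop :=
  ∃ x : X, 0 ≤ x ∧ w - z = j x

/-- The relation `z ≽ w` on `E`: there is a constant `c > 0` with `c w ≤ z`. -/
def StronglyGE {X E : Type*} [AddCommGroup X] [Module ℝ X] [Lattice X]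
    [NormedAddCommGroup E] [NormedSpace ℂ E] (j : X →ₗ[ℝ] E) (z w : E) : Prop :=
  ∃ c : ℝ, 0 < c ∧ ComplexLE j (c • w) z

/-- The principal ideal `E_u` consists of all `z : E` with `u ≽ |z|`. -/
def principalIdeal {X E : Type*} [AddCommGroup X] [Module ℝ X] [Lattice X]
    [NormedAddCommGroup E] [NormedSpace ℂ E] (j : X →ₗ[ℝ] E) (u : X) : Set E :=
  {z | ∃ m : X, IsModulus j z m ∧ StronglyGE j (j u) (j m)}

/-- A positive vector `u` is a quasi-interior point of `E` if the principal ideal `E_u` is dense. -/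
def IsQuasiInterior {X E : Type*} [AddCommGroup X] [Module ℝ X] [Lattice X]
    [NormedAddCommGroup E] [NormedSpace ℂ E]
    (j : X →ₗ[ℝ] E) (u : X) : Prop :=
  0 ≤ u ∧ Dense (principalIdeal j u)

/-- An operator `A : E ⊇ dom A → E` is real if `dom A` is spanned by the real vectors it contains
and `A` maps real vectors to real vectors. -/
def IsRealOperator {X E : Type*} [AddCommGroup X] [Module ℝ X]
    [NormedAddCommGroup E] [NormedSpace ℂ E] (j : X →ₗ[ℝ] E) (A : E →ₗ.[ℂ] E) : Prop :=
  Submodule.span ℂ ((A.domain : Set E) ∩ Set.range j) = A.domain ∧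
    ∀ z : A.domain, (z : E) ∈ Set.range j → A z ∈ Set.range j

/-- `R` is a bounded two-sided inverse of `μ - A : dom A → E`. -/
def IsResolventAt {E : Type*} [NormedAddCommGroup E] [NormedSpace ℂ E]
    (A : E →ₗ.[ℂ] E) (μ : ℂ) (R : E →L[ℂ] E) : Prop :=
  (∀ f : E, ∃ h : R f ∈ A.domain, μ • R f - A ⟨R f, h⟩ = f) ∧
    ∀ z : A.domain, R (μ • (z : E) - A z) = z

theorem IsResolventAt.unique {E : Type*} [NormedAddCommGroup E] [NormedSpace ℂ E]
    {A : E →ₗ.[ℂ] E} {μ : ℂ} {R S : E →L[ℂ] E}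
    (hR : IsResolventAt A μ R) (hS : IsResolventAt A μ S) : R = S := by
  ext f
  obtain ⟨h, e⟩ := hS.1 f
  have := hR.2 ⟨S f, h⟩
  simpa only [e] using this

/-- The resolvent set `ρ(A)`. -/
def pmapResolventSet {E : Type*} [NormedAddCommGroup E] [NormedSpace ℂ E]
    (A : E →ₗ.[ℂ] E) : Set ℂ :=
  {μ | ∃ R : E →L[ℂ] E, IsResolventAt A μ R}

/-- The spectrum `σ(A)`. -/
def pmapSpectrum {E : Type*} [NormedAddCommGroup E] [NormedSpace ℂ E]
    (A : E →ₗ.[ℂ] E) : Set ℂ :=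
  (pmapResolventSet A)ᶜ

open Classical in
/-- The resolvent `R(μ, A) = (μ - A)⁻¹` for `μ ∈ ρ(A)`; it has the value `0` outside `ρ(A)`. -/
noncomputable def pmapResolvent {E : Type*} [NormedAddCommGroup E] [NormedSpace ℂ E]
    (A : E →ₗ.[ℂ] E) (μ : ℂ) : E →L[ℂ] E :=
  if h : ∃ R : E →L[ℂ] E, IsResolventAt A μ R then h.choose else 0

theorem isResolventAt_pmapResolvent {E : Type*} [NormedAddCommGroup E] [NormedSpace ℂ E]
    {A : E →ₗ.[ℂ] E} {μ : ℂ} (hμ : μ ∈ pmapResolventSet A) :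
    IsResolventAt A μ (pmapResolvent A μ) := by
  have h : ∃ R : E →L[ℂ] E, IsResolventAt A μ R := hμ
  rw [pmapResolvent, dif_pos h]
  exact h.choose_spec

/-- `μ₀` is a pole of the resolvent of `A`: a punctured neighbourhood of `μ₀` lies in the resolvent
set, and there the operator-valued map `μ ↦ R(μ, A)` has a pole (of some order `≥ 1`) at `μ₀`. -/
def IsPoleOfResolvent {E : Type*} [NormedAddCommGroup E] [NormedSpace ℂ E]
    (A : E →ₗ.[ℂ] E) (μ₀ : ℂ) : Prop :=
  (∀ᶠ μ in 𝓝[≠] μ₀, μ ∈ pmapResolventSet A) ∧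
    MeromorphicAt (pmapResolvent A) μ₀ ∧ meromorphicOrderAt (pmapResolvent A) μ₀ < 0

/-! Let `P` and `Q` be the leading Laurent coefficients at `l₀` of the resolvents of `B` and `A`;
both are positive. Since `P R(l, B) = (l - l₀)⁻¹ P` and `R(l, B) g ≽ u`, a vector `0 ≤ g ≠ 0` with
`P g = 0` would give `P u = 0`, hence `P = 0`; so `P` is strictly positive
(`IsQuasiInterior.eq_zero_of_map_eq_zero_of_stronglyGE`). A pole of higher order would have `P² =
0`, so the pole of `B` is simple and `P` is a projection. By domination the pole of `A` is simple
too, and `Q ≤ P` is a projection.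

A positive `w ≠ 0` with `Q w = w` is then fixed by `P`, so both resolvents send `w` to `(l - l₀)⁻¹
w`, and `w ≽ u`. The positive difference of the resolvents kills `w`, hence `[0, w]`, for `l` near
`l₀` depending on the vector. The identity theorem removes this dependence, and density of `E_u`
makes the resolvents equal at one point. -/

theorem complexLE_zero_iff {X E : Type*} [AddCommGroup X] [Module ℝ X] [Lattice X]
    [NormedAddCommGroup E] [NormedSpace ℂ E] {j : X →ₗ[ℝ] E} {z : E} : ComplexLE j 0 z ↔ z ∈ j '' Set.Ici 0 := by
  simp [ComplexLE, eq_comm]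

theorem ofReal_smul_mem_image_Ici {X E : Type*} [NormedAddCommGroup X] [NormedSpace ℝ X]
    [Lattice X] [IsOrderedModule ℝ X] [NormedAddCommGroup E] [NormedSpace ℂ E] {j : X →ₗ[ℝ] E}
    {c : ℝ} (hc : 0 ≤ c) {z : E} (hz : z ∈ j '' Set.Ici 0) :
    (c : ℂ) • z ∈ j '' Set.Ici 0 := by
  obtain ⟨x, hx, rfl⟩ := hz
  exact ⟨c • x, smul_nonneg hc hx, by rw [map_smul, Complex.coe_smul]⟩

/-! ### Positive operators and quasi-interior points -/

section PositiveCone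

variable {X E : Type*}
    [NormedAddCommGroup X] [NormedSpace ℝ X] [CompleteSpace X]
    [Lattice X] [IsOrderedAddMonoid X] [IsOrderedModule ℝ X] [HasSolidNorm X]
    [NormedAddCommGroup E] [NormedSpace ℂ E] [CompleteSpace E] {j : X →ₗ[ℝ] E}

/-- In a complex Banach lattice the embedding of the real part is isometric. -/
theorem IsComplexBanachLattice.norm_map (hE : IsComplexBanachLattice j) (x : X) :
    ‖j x‖ = ‖x‖ := by
  obtain ⟨m, ⟨a, b, hz, hm⟩, hn⟩ := hE.exists_modulus (j x)
  obtain ⟨p, -, hp⟩ := hE.existsUnique_repr (j x)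
  have h1 := hp (a, b) hz
  have h2 := hp (x, 0) (by simp)
  have h3 : (a, b) = (x, (0 : X)) := h1.trans h2.symm
  obtain ⟨rfl, rfl⟩ : a = x ∧ b = 0 := by simpa using h3
  have habs : |a| = m := by
    apply le_antisymm
    · refine abs_le'.2 ⟨?_, ?_⟩
      · exact hm.1 ⟨0, by simp⟩
      · exact hm.1 ⟨Real.pi, by simp⟩
    · refine hm.2 ?_
      rintro _ ⟨θ, rfl⟩
      simp only [smul_zero, add_zero]
      have h0 : 0 ≤ |a| := abs_nonneg a
      rcases le_total 0 (Real.cos θ) with hc | hc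
      · calc Real.cos θ • a ≤ Real.cos θ • |a| := smul_le_smul_of_nonneg_left (le_abs_self a) hc
          _ ≤ (1 : ℝ) • |a| := smul_le_smul_of_nonneg_right (Real.cos_le_one θ) h0
          _ = |a| := one_smul _ _
      · calc Real.cos θ • a = (-Real.cos θ) • (-a) := by simp
          _ ≤ (-Real.cos θ) • |a| :=
            smul_le_smul_of_nonneg_left (neg_le_abs a) (by linarith)
          _ ≤ (1 : ℝ) • |a| :=
            smul_le_smul_of_nonneg_right (by linarith [Real.neg_one_le_cos θ]) h0
          _ = |a| := one_smul _ _
  rw [hn, ← habs, norm_abs_eq_norm]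

theorem IsComplexBanachLattice.isometry (hE : IsComplexBanachLattice j) : Isometry j :=
  AddMonoidHomClass.isometry_of_norm j hE.norm_map

theorem IsComplexBanachLattice.injective (hE : IsComplexBanachLattice j) :
    Function.Injective j := hE.isometry.injective

/-- The positive cone of the real part is closed in a complex Banach lattice. -/
theorem IsComplexBanachLattice.isClosed_image_Ici (hE : IsComplexBanachLattice j) :
    IsClosed (j '' Set.Ici 0) :=
  hE.isometry.isClosedEmbedding.isClosedMap _ isClosed_Ici

theorem complexLE_map_iff (hE : IsComplexBanachLattice j) {x y : X} :
    ComplexLE j (j x) (j y) ↔ x ≤ y := by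
  constructor
  · rintro ⟨t, ht, h⟩
    rw [← map_sub] at h
    have := hE.injective h
    rwa [← this, sub_nonneg] at ht
  · exact fun h => ⟨y - x, sub_nonneg.2 h, (map_sub j y x).symm⟩

/-- A bounded operator is determined by its values on an order interval `[0, w]` as soon as
`w` dominates a positive multiple of a quasi-interior point. -/
theorem IsQuasiInterior.eq_zero_of_forall_mem_Icc {u w : X}
    (hE : IsComplexBanachLattice j) (hu : IsQuasiInterior j u) {c : ℝ} (hc : 0 < c)
    (hcw : c • u ≤ w) {T : E →L[ℂ] E} (hT : ∀ f : X, 0 ≤ f → f ≤ w → T (j f) = 0) :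
    T = 0 := by
  have hpos : ∀ (C : ℝ) (f : X), 0 < C → 0 ≤ f → f ≤ C • w → T (j f) = 0 := by
    intro C f hC hf hfw
    have h := hT (C⁻¹ • f) (smul_nonneg (by positivity) hf) (by
      have := smul_le_smul_of_nonneg_left hfw (inv_nonneg.2 hC.le)
      rwa [smul_smul, inv_mul_cancel₀ hC.ne', one_smul] at this)
    rw [map_smul, ← Complex.coe_smul, map_smul] at h
    exact (smul_eq_zero.1 h).resolve_left (by simpa using hC.ne')
  have hreal : ∀ (C : ℝ) (x : X), 0 < C → |x| ≤ C • w → T (j x) = 0 := by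
    intro C x hC hx
    have h1 := hpos C x⁺ hC (posPart_nonneg x) ((sup_le (le_abs_self x) (abs_nonneg x)).trans hx)
    have h2 := hpos C x⁻ hC (negPart_nonneg x) ((sup_le (neg_le_abs x) (abs_nonneg x)).trans hx)
    rw [← posPart_sub_negPart x, map_sub, map_sub, h1, h2, sub_zero]
  have hzero : Set.EqOn T (0 : E →L[ℂ] E) (principalIdeal j u) := by
    rintro z ⟨m, ⟨x, y, rfl, hm⟩, d, hd, hmu⟩
    have hmu' : d • m ≤ u := by
      rw [← map_smul] at hmu
      exact (complexLE_map_iff hE).1 hmu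
    have hmw : m ≤ (d * c)⁻¹ • w := by
      have h1 : (c * d) • m ≤ w := by
        rw [mul_smul]
        exact (smul_le_smul_of_nonneg_left hmu' hc.le).trans hcw
      have h2 := smul_le_smul_of_nonneg_left h1 (inv_nonneg.2 (mul_pos hd hc).le)
      rwa [smul_smul, mul_comm c d, inv_mul_cancel₀ (mul_pos hd hc).ne', one_smul] at h2
    -- The angles `0`, `π` and `±π/2` give `±x ≤ m` and `±y ≤ m`.
    have hx : |x| ≤ m := abs_le'.2 ⟨hm.1 ⟨0, by simp⟩, hm.1 ⟨Real.pi, by simp⟩⟩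
    have hy : |y| ≤ m := abs_le'.2 ⟨hm.1 ⟨Real.pi / 2, by simp⟩,
      hm.1 ⟨-(Real.pi / 2), by simp [Real.cos_neg, Real.sin_neg]⟩⟩
    have hC : 0 < (d * c)⁻¹ := inv_pos.2 (mul_pos hd hc)
    simp [hreal _ x hC (hx.trans hmw), hreal _ y hC (hy.trans hmw)]
  exact DFunLike.coe_injective (Continuous.ext_on hu.2 T.continuous (0 : E →L[ℂ] E).continuous hzero)

theorem IsComplexBanachLattice.eq_zero_of_forall_nonneg (hE : IsComplexBanachLattice j)
    {T : E →L[ℂ] E} (hT : ∀ f : X, 0 ≤ f → T (j f) = 0) : T = 0 := by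
  have hreal : ∀ x : X, T (j x) = 0 := fun x => by
    rw [← posPart_sub_negPart x, map_sub, map_sub, hT _ (posPart_nonneg x),
      hT _ (negPart_nonneg x), sub_zero]
  ext z
  obtain ⟨p, rfl, -⟩ := hE.existsUnique_repr z
  simp [hreal]

/-- A positive operator that vanishes at a quasi-interior point is zero. -/
theorem IsQuasiInterior.eq_zero_of_map_eq_zero {u : X}
    (hE : IsComplexBanachLattice j) (hu : IsQuasiInterior j u) {T : E →L[ℂ] E}
    (hT : ∀ f : X, 0 ≤ f → T (j f) ∈ j '' Set.Ici 0) (hTu : T (j u) = 0) : T = 0 := by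
  refine hu.eq_zero_of_forall_mem_Icc hE one_pos (one_smul ℝ u).le fun f hf hfu => ?_
  obtain ⟨a, ha, hfa⟩ := hT f hf
  -- As `T u = 0`, both `T f` and `T (u - f) = -T f` are positive.
  obtain ⟨b, hb, hfb⟩ := hT (u - f) (sub_nonneg.2 hfu)
  rw [map_sub, map_sub, hTu, ← hfa, zero_sub, ← map_neg] at hfb
  have hab : b = -a := hE.injective hfb
  have ha0 : a = 0 := le_antisymm (by
    have : (0 : X) ≤ -a := hab ▸ hb
    exact neg_nonneg.1 this) ha
  rw [← hfa, ha0, map_zero]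

end PositiveCone

/-! ### Resolvents and their Laurent expansions -/

section Resolvent

variable {E : Type*} [NormedAddCommGroup E] [NormedSpace ℂ E] {A B : E →ₗ.[ℂ] E}

/-- The resolvent identity. -/
theorem IsResolventAt.mul_eq {μ ν : ℂ} {R S : E →L[ℂ] E}
    (hR : IsResolventAt A μ R) (hS : IsResolventAt A ν S) :
    (ν - μ) • (R * S) = R - S := by
  ext f
  obtain ⟨h, e⟩ := hS.1 f
  have h1 := hR.2 ⟨S f, h⟩
  simp only at h1
  rw [show A ⟨S f, h⟩ = ν • S f - f from eq_sub_of_add_eq' (sub_eq_iff_eq_add.1 e).symm] at h1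
  simp only [map_sub, map_smul] at h1
  change (ν - μ) • R (S f) = R f - S f
  refine eq_sub_of_add_eq ?_
  nth_rw 2 [← h1]
  rw [sub_smul]
  abel

/-- Operators with a common resolvent coincide. -/
theorem IsResolventAt.operator_eq {μ : ℂ} {R : E →L[ℂ] E}
    (hA : IsResolventAt A μ R) (hB : IsResolventAt B μ R) : A = B := by
  have key : ∀ {A B : E →ₗ.[ℂ] E}, IsResolventAt A μ R → IsResolventAt B μ R → A ≤ B := by
    intro A B hA hB
    have hmem : ∀ z : A.domain, ∃ h : (z : E) ∈ B.domain, B ⟨z, h⟩ = A z := by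
      intro z
      obtain ⟨h, e⟩ := hB.1 (μ • (z : E) - A z)
      have hz := hA.2 z
      simp only [hz] at h e
      exact ⟨h, sub_right_injective e⟩
    refine ⟨fun z hz => (hmem ⟨z, hz⟩).1, ?_⟩
    rintro ⟨x, hx⟩ ⟨y, hy⟩ (rfl : x = y)
    exact (hmem ⟨x, hx⟩).2.symm
  exact le_antisymm (key hA hB) (key hB hA)

/-- The leading Laurent coefficient `L` of the resolvent at a pole of order `m`, and its
algebraic relations with the resolvent. -/
theorem IsPoleOfResolvent.exists_leadingCoeff {μ₀ : ℂ} (h : IsPoleOfResolvent A μ₀) :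
    ∃ (m : ℕ) (L : E →L[ℂ] E), L ≠ 0 ∧
      Tendsto (fun z => (z - μ₀) ^ (m + 1) • pmapResolvent A z) (𝓝[≠] μ₀) (𝓝 L) ∧
      (∀ᶠ z in 𝓝[≠] μ₀, L * pmapResolvent A z = (z - μ₀)⁻¹ • L) ∧
      (∀ᶠ z in 𝓝[≠] μ₀, pmapResolvent A z * L = (z - μ₀)⁻¹ • L) := by
  obtain ⟨hres, hmero, hneg⟩ := h
  obtain ⟨k, hk⟩ := WithTop.ne_top_iff_exists.1 hneg.ne_top
  rw [← hk] at hneg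
  have hk0 : k < 0 := by exact_mod_cast hneg
  obtain ⟨g, hg, hg0, hgR⟩ := (meromorphicOrderAt_eq_int_iff hmero).1 hk.symm
  -- The order is written `m + 1`, so `m = 0` means a simple pole.
  obtain ⟨m, rfl⟩ : ∃ m : ℕ, k = -((m + 1 : ℕ) : ℤ) := ⟨(-k - 1).toNat, by omega⟩
  have hlim : Tendsto (fun z => (z - μ₀) ^ (m + 1) • pmapResolvent A z) (𝓝[≠] μ₀)
      (𝓝 (g μ₀)) := by
    refine (hg.continuousAt.tendsto.mono_left nhdsWithin_le_nhds).congr' ?_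
    filter_upwards [hgR, self_mem_nhdsWithin] with z hz hne
    have : z - μ₀ ≠ 0 := sub_ne_zero.2 hne
    rw [hz, smul_smul, zpow_neg, zpow_natCast, mul_inv_cancel₀ (pow_ne_zero _ this), one_smul]
  have hsmall : Tendsto (fun z : ℂ => (z - μ₀) ^ (m + 1)) (𝓝[≠] μ₀) (𝓝 0) := by
    have : ContinuousAt (fun z : ℂ => (z - μ₀) ^ (m + 1)) μ₀ := by fun_prop
    simpa [ContinuousAt] using this.tendsto.mono_left nhdsWithin_le_nhds
  have hid : Tendsto (fun z : ℂ => z) (𝓝[≠] μ₀) (𝓝 μ₀) := nhdsWithin_le_nhds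
  refine ⟨m, g μ₀, hg0, hlim, ?_, ?_⟩
  · filter_upwards [hres, self_mem_nhdsWithin] with w hw hne
    -- Multiply `(w - z) R(z) R(w) = R(z) - R(w)` by `(z - μ₀) ^ (m + 1)` and let `z → μ₀`.
    have h1 := ((tendsto_const_nhds (x := w)).sub hid).smul
      (hlim.mul (tendsto_const_nhds (x := pmapResolvent A w)))
    have h2 : Tendsto (fun z => (z - μ₀) ^ (m + 1) • pmapResolvent A z -
        (z - μ₀) ^ (m + 1) • pmapResolvent A w) (𝓝[≠] μ₀) (𝓝 (g μ₀ - 0)) := by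
      simpa using hlim.sub (hsmall.smul (tendsto_const_nhds (x := pmapResolvent A w)))
    have h3 := tendsto_nhds_unique_of_eventuallyEq h1 h2 (by
      filter_upwards [hres] with z hz
      rw [← smul_sub, ← (isResolventAt_pmapResolvent hz).mul_eq (isResolventAt_pmapResolvent hw),
        smul_mul_assoc, smul_comm])
    rw [sub_zero] at h3
    have hw0 : w - μ₀ ≠ 0 := sub_ne_zero.2 hne
    rw [eq_inv_smul_iff₀ hw0]
    exact h3
  · filter_upwards [hres, self_mem_nhdsWithin] with w hw hne
    have h1 := (hid.sub (tendsto_const_nhds (x := w))).smul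
      ((tendsto_const_nhds (x := pmapResolvent A w)).mul hlim)
    have h2 : Tendsto (fun z => (z - μ₀) ^ (m + 1) • pmapResolvent A w -
        (z - μ₀) ^ (m + 1) • pmapResolvent A z) (𝓝[≠] μ₀) (𝓝 (0 - g μ₀)) := by
      simpa using (hsmall.smul (tendsto_const_nhds (x := pmapResolvent A w))).sub hlim
    have h3 := tendsto_nhds_unique_of_eventuallyEq h1 h2 (by
      filter_upwards [hres] with z hz
      rw [← smul_sub, ← (isResolventAt_pmapResolvent hw).mul_eq (isResolventAt_pmapResolvent hz),
        mul_smul_comm, smul_comm])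
    have hw0 : w - μ₀ ≠ 0 := sub_ne_zero.2 hne
    rw [eq_inv_smul_iff₀ hw0, ← neg_inj, ← neg_smul, neg_sub]
    simpa using h3

/-- The square of the leading coefficient is determined by the order of the pole. -/
theorem leadingCoeff_mul_self {μ₀ : ℂ} {m : ℕ} {R : ℂ → E →L[ℂ] E} {L : E →L[ℂ] E}
    (hlim : Tendsto (fun z => (z - μ₀) ^ (m + 1) • R z) (𝓝[≠] μ₀) (𝓝 L))
    (hL : ∀ᶠ z in 𝓝[≠] μ₀, L * R z = (z - μ₀)⁻¹ • L) :
    L * L = (0 : ℂ) ^ m • L := by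
  -- Since `0 ^ 0 = 1`, the limit makes `L` idempotent for `m = 0` and `L² = 0` otherwise.
  have h1 := (tendsto_const_nhds (x := L)).mul hlim
  have hc : ContinuousAt (fun z : ℂ => (z - μ₀) ^ m • L) μ₀ := by fun_prop
  have h2 : Tendsto (fun z : ℂ => (z - μ₀) ^ m • L) (𝓝[≠] μ₀) (𝓝 ((0 : ℂ) ^ m • L)) := by
    simpa [ContinuousAt] using hc.tendsto.mono_left nhdsWithin_le_nhds
  refine tendsto_nhds_unique_of_eventuallyEq h1 h2 ?_
  filter_upwards [hL, self_mem_nhdsWithin] with z hz hne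
  have : z - μ₀ ≠ 0 := sub_ne_zero.2 hne
  rw [mul_smul_comm, hz, smul_smul, pow_succ, mul_assoc, mul_inv_cancel₀ this, mul_one]

/-- If `D` is meromorphic at `x`, then a single punctured neighbourhood of `x` serves all vectors
`f` for which `D z f` vanishes at points `z` accumulating at `x`. -/
theorem MeromorphicAt.eventually_forall_apply_eq_zero [CompleteSpace E] {D : ℂ → E →L[ℂ] E} {x : ℂ}
    (hD : MeromorphicAt D x) :
    ∀ᶠ z in 𝓝[≠] x, ∀ f : E, (∃ᶠ y in 𝓝[≠] x, D y f = 0) → D z f = 0 := by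
  obtain ⟨n, hn⟩ := hD
  obtain ⟨r, hr, hball⟩ := Metric.eventually_nhds_iff_ball.1 hn.eventually_analyticAt
  filter_upwards [self_mem_nhdsWithin, nhdsWithin_le_nhds (Metric.ball_mem_nhds x hr)]
    with z hne hz f hf
  -- The radius `r` comes from `D` alone, so the identity theorem applies on the same ball for every
  -- `f`.
  have han : AnalyticOnNhd ℂ (fun y => ((y - x) ^ n • D y) f) (Metric.ball x r) := fun y hy =>
    ((ContinuousLinearMap.apply ℂ E f).analyticAt _).comp (hball y hy)
  have := han.eqOn_zero_of_preconnected_of_frequently_eq_zero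
    (convex_ball x r).isPreconnected (Metric.mem_ball_self hr)
    (hf.mono fun y hy => by simp [hy]) hz
  simp only [smul_apply, Pi.zero_apply] at this
  exact (smul_eq_zero.1 this).resolve_left (pow_ne_zero _ (sub_ne_zero.2 hne))

end Resolvent

/-- Links order estimates, made for real `l > l₀`, to Laurent expansions in the complex plane. -/
theorem tendsto_ofReal_nhdsGT_nhdsNE (a : ℝ) :
    Tendsto (fun t : ℝ => (t : ℂ)) (𝓝[>] a) (𝓝[≠] (a : ℂ)) := by
  refine tendsto_nhdsWithin_iff.2
    ⟨(Complex.continuous_ofReal.tendsto a).mono_left nhdsWithin_le_nhds, ?_⟩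
  filter_upwards [self_mem_nhdsWithin] with t ht
  have : t ≠ a := ne_of_gt ht
  simpa using this

/-! ### Positivity of leading coefficients -/

section Positivity

variable {X E : Type*}
    [NormedAddCommGroup X] [NormedSpace ℝ X] [CompleteSpace X]
    [Lattice X] [IsOrderedAddMonoid X] [IsOrderedModule ℝ X] [HasSolidNorm X]
    [NormedAddCommGroup E] [NormedSpace ℂ E] [CompleteSpace E] {j : X →ₗ[ℝ] E}

/-- Positivity of a family of operators to the right of a real point passes to the limit of
`(z - l₀) ^ m • R z`. -/
theorem IsComplexBanachLattice.map_mem_of_tendsto (hE : IsComplexBanachLattice j) {l₀ : ℝ}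
    {m : ℕ} {R : ℂ → E →L[ℂ] E} {L : E →L[ℂ] E}
    (hlim : Tendsto (fun z : ℂ => (z - l₀) ^ m • R z) (𝓝[≠] (l₀ : ℂ)) (𝓝 L)) {f : E}
    (hpos : ∀ᶠ l : ℝ in 𝓝[>] l₀, R l f ∈ j '' Set.Ici 0) :
    L f ∈ j '' Set.Ici 0 := by
  have h := ((ContinuousLinearMap.apply ℂ E f).continuous.tendsto L).comp
    (hlim.comp (tendsto_ofReal_nhdsGT_nhdsNE l₀))
  refine hE.isClosed_image_Ici.mem_of_tendsto h ?_
  filter_upwards [hpos, self_mem_nhdsWithin] with l hl hlt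
  have hnn : 0 ≤ (l - l₀) ^ m := pow_nonneg (sub_nonneg.2 (le_of_lt hlt)) m
  have := ofReal_smul_mem_image_Ici hnn hl
  simpa using this

/-- Let `L` be a nonzero positive operator with `L R(l) = (l - l₀)⁻¹ L` for `l > l₀` close to `l₀`.
If `R(l) g ≽ u` for such `l` whenever `0 ≤ g ≠ 0`, then `L` is strictly positive. -/
theorem IsQuasiInterior.eq_zero_of_map_eq_zero_of_stronglyGE {u : X}
    (hE : IsComplexBanachLattice j) (hu : IsQuasiInterior j u) {l₀ : ℝ}
    {R : ℂ → E →L[ℂ] E} {L : E →L[ℂ] E} (hL : L ≠ 0)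
    (hLpos : ∀ f : X, 0 ≤ f → L (j f) ∈ j '' Set.Ici 0)
    (hLR : ∀ᶠ z in 𝓝[≠] (l₀ : ℂ), L * R z = (z - l₀)⁻¹ • L)
    (h_pos : ∀ f : X, 0 ≤ f → f ≠ 0 → ∀ᶠ l : ℝ in 𝓝[>] l₀, StronglyGE j (R l (j f)) (j u))
    {g : X} (hg : 0 ≤ g) (hLg : L (j g) = 0) : g = 0 := by
  by_contra hg0
  obtain ⟨l, ⟨c, hc, x, hx, hxe⟩, hl⟩ :=
    ((h_pos g hg hg0).and ((tendsto_ofReal_nhdsGT_nhdsNE l₀).eventually hLR)).exists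
  refine hL (hu.eq_zero_of_map_eq_zero hE hLpos ?_)
  obtain ⟨a, ha, hae⟩ := hLpos u hu.1
  obtain ⟨b, hb, hbe⟩ := hLpos x hx
  have h1 : L (R l (j g)) = 0 := by
    have := congrArg (fun T : E →L[ℂ] E => T (j g)) hl
    simpa [hLg] using this
  -- With `x = R(l) g - c u ≥ 0`, positivity of `L x = -c L u` forces `L u = 0`.
  rw [← hxe, map_sub, h1, ← Complex.coe_smul, map_smul, ← hae, zero_sub, Complex.coe_smul,
    ← map_smul, ← map_neg] at hbe
  have hba := hE.injective hbe
  have hca : c • a ≤ 0 := by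
    have : (0 : X) ≤ -(c • a) := hba ▸ hb
    exact neg_nonneg.1 this
  have ha0 : a = 0 := by
    have h0 := le_antisymm hca (smul_nonneg hc.le ha)
    exact (smul_eq_zero.1 h0).resolve_left hc.ne'
  rw [← hae, ha0, map_zero]

theorem IsComplexBanachLattice.exists_nonneg_map_ne_zero (hE : IsComplexBanachLattice j)
    {L : E →L[ℂ] E} (hL : L ≠ 0) (hLpos : ∀ f : X, 0 ≤ f → L (j f) ∈ j '' Set.Ici 0) :
    ∃ f v : X, 0 ≤ f ∧ 0 ≤ v ∧ v ≠ 0 ∧ L (j f) = j v := by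
  by_contra! hcon
  refine hL (hE.eq_zero_of_forall_nonneg fun f hf => ?_)
  obtain ⟨v, hv, hve⟩ := hLpos f hf
  by_cases hv0 : v = 0
  · rw [← hve, hv0, map_zero]
  · exact absurd hve.symm (hcon f v hf hv hv0)

end Positivity

/-! ### Equality of the operators -/

theorem mainTheorem2 {X E : Type*}
    [NormedAddCommGroup X] [NormedSpace ℝ X] [CompleteSpace X]
    [Lattice X] [IsOrderedAddMonoid X] [IsOrderedModule ℝ X] [HasSolidNorm X]
    [NormedAddCommGroup E] [NormedSpace ℂ E] [CompleteSpace E]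
    (j : X →ₗ[ℝ] E) (hE : IsComplexBanachLattice j)
    (A B : E →ₗ.[ℂ] E)
    (hA_closed : A.IsClosed) (hA_dense : Dense (A.domain : Set E)) (hA_real : IsRealOperator j A)
    (hB_closed : B.IsClosed) (hB_dense : Dense (B.domain : Set E)) (hB_real : IsRealOperator j B)
    (u : X) (hu : IsQuasiInterior j u)
    (l₀ : ℝ)
    (hB_spec : (l₀ : ℂ) ∈ pmapSpectrum B) (hB_pole : IsPoleOfResolvent B (l₀ : ℂ))
    (h_dom : ∀ f : X, 0 ≤ f → ∀ᶠ l : ℝ in 𝓝[>] l₀,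
      ComplexLE j 0 (pmapResolvent A (l : ℂ) (j f)) ∧
        ComplexLE j (pmapResolvent A (l : ℂ) (j f)) (pmapResolvent B (l : ℂ) (j f)))
    (h_pos : ∀ f : X, 0 ≤ f → f ≠ 0 → ∀ᶠ l : ℝ in 𝓝[>] l₀,
      StronglyGE j (pmapResolvent B (l : ℂ) (j f)) (j u))
    (hA_spec : (l₀ : ℂ) ∈ pmapSpectrum A) (hA_pole : IsPoleOfResolvent A (l₀ : ℂ)) :
    A = B := by
  have hRA : ∀ f : X, 0 ≤ f → ∀ᶠ l : ℝ in 𝓝[>] l₀,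
      pmapResolvent A (l : ℂ) (j f) ∈ j '' Set.Ici 0 := fun f hf =>
    (h_dom f hf).mono fun l hl => complexLE_zero_iff.1 hl.1
  have hD : ∀ f : X, 0 ≤ f → ∀ᶠ l : ℝ in 𝓝[>] l₀,
      (pmapResolvent B l - pmapResolvent A l) (j f) ∈ j '' Set.Ici 0 := fun f hf =>
    (h_dom f hf).mono fun l hl => by
      obtain ⟨x, hx, hxe⟩ := hl.2
      exact ⟨x, hx, hxe.symm⟩
  have hRB : ∀ f : X, 0 ≤ f → ∀ᶠ l : ℝ in 𝓝[>] l₀,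
      pmapResolvent B (l : ℂ) (j f) ∈ j '' Set.Ici 0 := fun f hf => by
    filter_upwards [hRA f hf, hD f hf] with l ⟨x, hx, hxe⟩ ⟨y, hy, hye⟩
    exact ⟨x + y, add_nonneg hx hy, by simp [hxe, hye]⟩
  -- The resolvent of `B` has a simple pole with strictly positive residue `P`.
  obtain ⟨m, P, hP0, hPlim, hPR, hRP⟩ := hB_pole.exists_leadingCoeff
  have hPpos : ∀ f : X, 0 ≤ f → P (j f) ∈ j '' Set.Ici 0 := fun f hf =>
    hE.map_mem_of_tendsto hPlim (hRB f hf)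
  have hPstrict : ∀ g : X, 0 ≤ g → P (j g) = 0 → g = 0 := fun g hg hPg =>
    hu.eq_zero_of_map_eq_zero_of_stronglyGE hE hP0 hPpos hPR h_pos hg hPg
  have hPP := leadingCoeff_mul_self hPlim hPR
  obtain rfl : m = 0 := by
    by_contra hm
    rw [zero_pow hm, zero_smul] at hPP
    obtain ⟨f, v, -, hv, hv0, hfv⟩ := hE.exists_nonneg_map_ne_zero hP0 hPpos
    refine hv0 (hPstrict v hv ?_)
    rw [← hfv]
    exact congrArg (fun T : E →L[ℂ] E => T (j f)) hPP
  rw [pow_zero, one_smul] at hPP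
  -- By domination, the resolvent of `A` has a simple pole with residue `Q ≤ P`.
  obtain ⟨n, Q, hQ0, hQlim, hQR, hRQ⟩ := hA_pole.exists_leadingCoeff
  have hQpos : ∀ f : X, 0 ≤ f → Q (j f) ∈ j '' Set.Ici 0 := fun f hf =>
    hE.map_mem_of_tendsto hQlim (hRA f hf)
  obtain rfl : n = 0 := by
    by_contra hn
    refine hQ0 (hE.eq_zero_of_forall_nonneg fun f hf => ?_)
    have hc : ContinuousAt (fun z : ℂ => (z - l₀) ^ n) (l₀ : ℂ) := by fun_prop
    have hz : Tendsto (fun z : ℂ => (z - l₀) ^ n) (𝓝[≠] (l₀ : ℂ)) (𝓝 0) := by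
      simpa [ContinuousAt, hn] using hc.tendsto.mono_left nhdsWithin_le_nhds
    -- For `n ≥ 1` the factor erases the simple pole of `B`, so domination leaves `-Q ≥ 0`.
    have hlim : Tendsto (fun z : ℂ => (z - l₀) ^ (n + 1) • (pmapResolvent B z - pmapResolvent A z))
        (𝓝[≠] (l₀ : ℂ)) (𝓝 (-Q)) := by
      have := (hz.smul hPlim).sub hQlim
      simpa [smul_smul, ← pow_succ, smul_sub] using this
    obtain ⟨a, ha, hae⟩ := hE.map_mem_of_tendsto hlim (hD f hf)
    obtain ⟨b, hb, hbe⟩ := hQpos f hf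
    rw [neg_apply, ← hbe, ← map_neg] at hae
    have hab := hE.injective hae
    have hb0 : b = 0 := le_antisymm (neg_nonneg.1 (hab ▸ ha)) hb
    rw [← hbe, hb0, map_zero]
  have hQQ := leadingCoeff_mul_self hQlim hQR
  rw [pow_zero, one_smul] at hQQ
  have hQP : ∀ f : X, 0 ≤ f → (P - Q) (j f) ∈ j '' Set.Ici 0 := fun f hf =>
    hE.map_mem_of_tendsto (R := fun z => pmapResolvent B z - pmapResolvent A z)
      (by simpa only [smul_sub] using hPlim.sub hQlim) (hD f hf)
  -- A nonzero positive vector `w` in the range of `Q` is fixed by both residues.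
  obtain ⟨f, w, -, hw, hw0, hfw⟩ := hE.exists_nonneg_map_ne_zero hQ0 hQpos
  have hQw : Q (j w) = j w := by
    rw [← hfw]
    exact congrArg (fun T : E →L[ℂ] E => T (j f)) hQQ
  have hPw : P (j w) = j w := by
    obtain ⟨g, hg, hge⟩ := hQP w hw
    rw [sub_apply, hQw] at hge
    -- Here `g = P w - w`, which `P` annihilates because `P² = P`.
    have hg0 : g = 0 := hPstrict g hg (by
      have := congrArg (fun T : E →L[ℂ] E => T (j w)) hPP
      rw [hge, map_sub, sub_eq_zero]
      exact this)
    rw [hg0, map_zero] at hge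
    exact (sub_eq_zero.1 hge.symm)
  have hRBw : ∀ᶠ z in 𝓝[≠] (l₀ : ℂ), pmapResolvent B z (j w) = (z - l₀)⁻¹ • j w :=
    hRP.mono fun z hz => by
      have := congrArg (fun T : E →L[ℂ] E => T (j w)) hz
      simpa [hPw] using this
  have hRAw : ∀ᶠ z in 𝓝[≠] (l₀ : ℂ), pmapResolvent A z (j w) = (z - l₀)⁻¹ • j w :=
    hRQ.mono fun z hz => by
      have := congrArg (fun T : E →L[ℂ] E => T (j w)) hz
      simpa [hQw] using this
  obtain ⟨c, hc, hcw⟩ : ∃ c : ℝ, 0 < c ∧ c • u ≤ w := by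
    obtain ⟨l, ⟨⟨c, hc, hcu⟩, hl⟩, hlt⟩ := (((h_pos w hw hw0).and
      ((tendsto_ofReal_nhdsGT_nhdsNE l₀).eventually hRBw)).and self_mem_nhdsWithin).exists
    have hlt' : 0 < l - l₀ := sub_pos.2 hlt
    have he : pmapResolvent B l (j w) = j ((l - l₀)⁻¹ • w) := by
      rw [hl, map_smul, ← Complex.coe_smul]
      push_cast
      rfl
    rw [he, ← map_smul, complexLE_map_iff hE] at hcu
    refine ⟨(l - l₀) * c, mul_pos hlt' hc, ?_⟩
    have := smul_le_smul_of_nonneg_left hcu hlt'.le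
    rwa [smul_smul, smul_smul, mul_inv_cancel₀ hlt'.ne', one_smul] at this
  -- The difference of the resolvents vanishes on the order interval `[0, w]`.
  have hDw : ∀ f : X, 0 ≤ f → f ≤ w → ∀ᶠ l : ℝ in 𝓝[>] l₀,
      (pmapResolvent B l - pmapResolvent A l) (j f) = 0 := by
    intro f hf hfw
    have ht := tendsto_ofReal_nhdsGT_nhdsNE l₀
    filter_upwards [hD f hf, hD (w - f) (sub_nonneg.2 hfw), ht.eventually hRBw,
      ht.eventually hRAw] with l ⟨a, ha, hae⟩ ⟨b, hb, hbe⟩ h1 h2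
    have h3 : (pmapResolvent B l - pmapResolvent A l) (j w) = 0 := by
      rw [sub_apply, h1, h2, sub_self]
    rw [map_sub, map_sub, h3, ← hae, zero_sub, ← map_neg] at hbe
    have hab := hE.injective hbe
    have ha0 : a = 0 := le_antisymm (neg_nonneg.1 (hab ▸ hb)) ha
    rw [← hae, ha0, map_zero]
  -- One `z` is fixed before `f`, although the range of `l` in `hDw` depends on `f`.
  obtain ⟨z, ⟨hzA, hzB⟩, hz⟩ := ((hA_pole.1.and hB_pole.1).and
    (hB_pole.2.1.sub hA_pole.2.1).eventually_forall_apply_eq_zero).exists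
  have hzero : pmapResolvent B z - pmapResolvent A z = 0 :=
    hu.eq_zero_of_forall_mem_Icc hE hc hcw fun f hf hfw =>
      hz (j f) ((tendsto_ofReal_nhdsGT_nhdsNE l₀).frequently (hDw f hf hfw).frequently)
  have hRA' := isResolventAt_pmapResolvent hzA
  rw [← sub_eq_zero.1 hzero] at hRA'
  exact hRA'.operator_eq (isResolventAt_pmapResolvent hzB)
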